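/- There is an absolute constant $c>0$ such that the following holds. Let $f$ be a probability density on $\mathbb{R}^d$ and let $\psi_1,\dots,\psi_K$ be polynomials in $d$ variables that are orthonormal with respect to $f$, i.e. $\int \psi_i\psi_j f\,d\xi=\delta_{ij}$. Put $B(\xi)=\big(\sum_{k=1}^K|\psi_k(\xi)|^2\big)^{1/2}$ and $\kappa=\big(\int fB^2\,d\xi\big)^{-1/2}$, and let $w(\xi)=1/(\kappa B(\xi))$ (with the value $0$ where $B(\xi)=0$). Let $M>K$ and let $\xi_1,\dots,\xi_M$ be coherence-optimal samples for this basis, i.e. independent random vectors with the probability density $f_Y=\kappa^2 fB^2$. Let $\Phi\in\mathbb{R}^{M\times K}$ be the matrix with entries $\Phi_{ij}=w(\xi_i)\psi_j(\xi_i)$, let $\mathbf{M}=\frac1M\Phi^T\Phi\in\mathbb{R}^{K\times K}$ be the information matrix, let $\phi_D(\mathbf{M})=\det(\mathbf{M})^{1/K}$, and let $\mu_K=\sup_{\xi\in\mathbb{R}^d}\sum_{j=1}^K|w(\xi)\psi_j(\xi)|^2$ be the coherence. Then for every $t\in(0,1)$, $$\mathbb{P}\big(\phi_D(\mathbf{M})\le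 t\big)\le 2K\exp\!\big[-c\,M\,\mu_K^{-1}(1-t)\big].$$ -/

import Mathlib

open MeasureTheory ProbabilityTheory

noncomputable section

namespace PCE

/-- `f` is a probability density function on `ℝ^d` (with respect to Lebesgue measure). -/
structure IsPDF {d : ℕ} (f : (Fin d → ℝ) → ℝ) : Prop where
  measurable : Measurable f
  nonneg : ∀ ξ, 0 ≤ f ξ
  integrable : Integrable f
  integral_eq_one : ∫ ξ, f ξ = 1

/-- The polynomials `ψ_1, …, ψ_K` are orthonormal with respect to the density `f`. (The case `i = j`
forces `ψ_i ^ 2 * f`, hence every `ψ_i * ψ_j * f`, to be integrable.) -/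
def IsOrthonormal {d K : ℕ} (f : (Fin d → ℝ) → ℝ) (ψ : Fin K → MvPolynomial (Fin d) ℝ) : Prop :=
  ∀ i j, ∫ ξ, MvPolynomial.eval ξ (ψ i) * MvPolynomial.eval ξ (ψ j) * f ξ = if i = j then 1 else 0

/-- `B(ξ) = √(∑_k |ψ_k(ξ)|²)`. -/
def B {d K : ℕ} (ψ : Fin K → MvPolynomial (Fin d) ℝ) (ξ : Fin d → ℝ) : ℝ :=
  Real.sqrt (∑ k, |MvPolynomial.eval ξ (ψ k)| ^ 2)

/-- The normalizing constant `(∫ f B²)^{-1/2}`. -/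
def normConst {d K : ℕ} (f : (Fin d → ℝ) → ℝ) (ψ : Fin K → MvPolynomial (Fin d) ℝ) : ℝ :=
  (∫ ξ, f ξ * B ψ ξ ^ 2) ^ (-(1 / 2) : ℝ)

/-- The coherence-optimal sampling density `f_Y = normConst² f B²`. -/
def samplingDensity {d K : ℕ} (f : (Fin d → ℝ) → ℝ) (ψ : Fin K → MvPolynomial (Fin d) ℝ)
    (ξ : Fin d → ℝ) : ℝ :=
  normConst f ψ ^ 2 * f ξ * B ψ ξ ^ 2

/-- The coherence-optimal sampling distribution: the law with density `f_Y`. -/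
def samplingLaw {d K : ℕ} (f : (Fin d → ℝ) → ℝ) (ψ : Fin K → MvPolynomial (Fin d) ℝ) :
    Measure (Fin d → ℝ) :=
  volume.withDensity fun ξ => ENNReal.ofReal (samplingDensity f ψ ξ)

/-- The weight function `w = 1 / (normConst B)` that goes with the coherence-optimal sampling
distribution. (The common zeros of the `ψ_k`, where it takes the value `0`, are null for
`samplingLaw`.) -/
def weight {d K : ℕ} (f : (Fin d → ℝ) → ℝ) (ψ : Fin K → MvPolynomial (Fin d) ℝ)
    (ξ : Fin d → ℝ) : ℝ :=
  1 / (normConst f ψ * B ψ ξ)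

/-- The coherence parameter `sup_ξ ∑_j |w(ξ) ψ_j(ξ)|²` of a weight function `w` and polynomials
`ψ_1, …, ψ_K`. -/
def coherence {d K : ℕ} (w : (Fin d → ℝ) → ℝ) (ψ : Fin K → MvPolynomial (Fin d) ℝ) : ℝ :=
  ⨆ ξ, ∑ j, |w ξ * MvPolynomial.eval ξ (ψ j)| ^ 2

/-- The matrix `Ψ(i,j) = ψ_j(ξ_i)`. -/
def basisMatrix {d K M : ℕ} (ψ : Fin K → MvPolynomial (Fin d) ℝ) (ξ : Fin M → Fin d → ℝ) :
    Matrix (Fin M) (Fin K) ℝ :=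
  Matrix.of fun i j => MvPolynomial.eval (ξ i) (ψ j)

/-- The measurement matrix `Φ = W Ψ`, where `W` is diagonal with `W(i,i) = w(ξ_i)`. -/
def measurementMatrix {d K M : ℕ} (w : (Fin d → ℝ) → ℝ) (ψ : Fin K → MvPolynomial (Fin d) ℝ)
    (ξ : Fin M → Fin d → ℝ) : Matrix (Fin M) (Fin K) ℝ :=
  Matrix.diagonal (fun i => w (ξ i)) * basisMatrix ψ ξ

/-- The information matrix `(1/M) Φᵀ Φ` of `M` samples. -/
def informationMatrix {d K M : ℕ} (w : (Fin d → ℝ) → ℝ) (ψ : Fin K → MvPolynomial (Fin d) ℝ)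
    (ξ : Fin M → Fin d → ℝ) : Matrix (Fin K) (Fin K) ℝ :=
  (1 / (M : ℝ)) • ((measurementMatrix w ψ ξ).transpose * measurementMatrix w ψ ξ)

/-- The D-optimality criterion `det(A)^{1/K}`. -/
def phiD {K : ℕ} (A : Matrix (Fin K) (Fin K) ℝ) : ℝ :=
  A.det ^ (1 / (K : ℝ))

end PCE

end

/-! The weight makes every row of the measurement matrix have squared norm exactly `K` off the
common zeros of the basis, a null set for the sampling law (`weight_sq_mul`, `ae_B_ne_zero`). So the
information matrix almost surely has trace `K`, and its eigenvalues have mean 1. In log det the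
first-order terms therefore cancel: if `phiD` is at most `t`, some eigenvalue is at distance at
least √(1-t)/2 from 1 (`exists_eigenvalue_of_phiD_le`). A matrix Chernoff bound is quadratic in this
deviation, hence linear in 1-t.

The Chernoff bound (`measureReal_trace_exp_ge_le`) applies Markov to the trace of an exponential.
Golden–Thompson (`trace_exp_add_le`) peels off one summand at a time, and isotropy makes the mean
exponential of each summand a scalar matrix. Golden–Thompson follows from the two-power trace
inequality and the Lie–Trotter formula along powers of two. -/

namespace Matrix

/-! ### Trace inequalities for powers of matrix products -/

variable {n : Type*} [Fintype n]

theorem trace_transpose_mul_self_nonneg (A : Matrix n n ℝ) : 0 ≤ (Aᵀ * A).trace := by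
  simp only [trace, diag_apply, mul_apply, transpose_apply]
  exact Finset.sum_nonneg fun i _ => Finset.sum_nonneg fun j _ => mul_self_nonneg _

theorem two_mul_trace_transpose_mul_le (A B : Matrix n n ℝ) :
    2 * (Aᵀ * B).trace ≤ (Aᵀ * A).trace + (Bᵀ * B).trace := by
  have h := trace_transpose_mul_self_nonneg (A - B)
  have h' : (Bᵀ * A).trace = (Aᵀ * B).trace := by
    rw [← trace_transpose, transpose_mul, transpose_transpose]
  simp only [transpose_sub, sub_mul, mul_sub, trace_sub, h'] at h
  linarith

variable [DecidableEq n]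

theorem trace_mul_pow_comm (A B : Matrix n n ℝ) (m : ℕ) :
    ((A * B) ^ m).trace = ((B * A) ^ m).trace := by
  cases m with
  | zero => simp
  | succ m =>
    have h : ∀ k : ℕ, (A * B) ^ k * A = A * (B * A) ^ k := fun k => by
      induction k with
      | zero => simp
      | succ k ih => rw [pow_succ', mul_assoc, ih, pow_succ', mul_assoc A B, mul_assoc B A]
    rw [pow_succ, ← mul_assoc, h, mul_assoc, trace_mul_comm, mul_assoc, ← pow_succ]

/-- A two-power form of the Lieb–Thirring inequality, together with Weyl's inequality. -/
theorem trace_pow_two_pow_aux (k : ℕ) :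
    (∀ X : Matrix n n ℝ, (X ^ 2 ^ (k + 1)).trace ≤ ((X * Xᵀ) ^ 2 ^ k).trace) ∧
    ∀ A B : Matrix n n ℝ, A.IsSymm → B.IsSymm →
      ((A * B) ^ 2 ^ k).trace ≤ (A ^ 2 ^ k * B ^ 2 ^ k).trace := by
  induction k with
  | zero =>
    refine ⟨fun X => ?_, fun A B _ _ => by simp⟩
    have h := two_mul_trace_transpose_mul_le Xᵀ X
    rw [transpose_transpose, trace_mul_comm Xᵀ X] at h
    simp only [zero_add, pow_one, pow_zero, sq]
    linarith
  | succ k ih =>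
    obtain ⟨hW, hC⟩ := ih
    constructor
    · intro X
      -- Up to cyclic rotation the Gram matrix of X² is a product of XᵀX and XXᵀ. The Lieb–Thirring
      -- half of the induction hypothesis separates the two factors, whose powers have equal traces.
      have h1 : ((X ^ 2 * (X ^ 2)ᵀ) ^ 2 ^ k).trace = (((Xᵀ * X) * (X * Xᵀ)) ^ 2 ^ k).trace := by
        rw [show X ^ 2 * (X ^ 2)ᵀ = (X * X * Xᵀ) * Xᵀ by
          simp only [sq, transpose_mul, mul_assoc], trace_mul_pow_comm]
        simp only [mul_assoc]
      have hs1 : (Xᵀ * X).IsSymm := by simp [IsSymm]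
      have hs2 : (X * Xᵀ).IsSymm := by simp [IsSymm]
      have h2 := hC _ _ hs1 hs2
      have h3 := two_mul_trace_transpose_mul_le ((Xᵀ * X) ^ 2 ^ k) ((X * Xᵀ) ^ 2 ^ k)
      rw [(hs1.pow _).eq, (hs2.pow _).eq, ← pow_add, ← pow_add, trace_mul_pow_comm Xᵀ X,
        ← two_mul, ← two_mul, ← pow_succ'] at h3
      have h4 := hW (X ^ 2)
      rw [← pow_mul, ← pow_succ', h1] at h4
      linarith
    · intro A B hA hB
      -- The Weyl half turns AB into AB²A, cyclically A²B², where the other half applies.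
      have h1 := hW (A * B)
      have e : A * B * (A * B)ᵀ = (A * B ^ 2) * A := by
        rw [transpose_mul, hA.eq, hB.eq, sq]; simp only [mul_assoc]
      rw [e, trace_mul_pow_comm (A * B ^ 2), ← mul_assoc, ← sq] at h1
      have h2 := hC _ _ (hA.pow 2) (hB.pow 2)
      rw [← pow_mul, ← pow_mul, ← pow_succ'] at h2
      exact h1.trans h2

theorem trace_mul_pow_two_pow_le {A B : Matrix n n ℝ} (hA : A.IsSymm) (hB : B.IsSymm) (k : ℕ) :
    ((A * B) ^ 2 ^ k).trace ≤ (A ^ 2 ^ k * B ^ 2 ^ k).trace :=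
  (trace_pow_two_pow_aux k).2 A B hA hB

end Matrix

/-! ### Exponentials in Banach algebras and the Lie–Trotter formula -/

section Trotter

open Filter Topology NormedSpace

variable {𝔸 : Type*} [NormedRing 𝔸]

theorem norm_pow_sub_pow_le [NormOneClass 𝔸] {a b : 𝔸} {r : ℝ} (ha : ‖a‖ ≤ r) (hb : ‖b‖ ≤ r) (hr : 1 ≤ r) (m : ℕ) :
    ‖a ^ m - b ^ m‖ ≤ m * r ^ m * ‖a - b‖ := by
  have hr0 : 0 ≤ r := zero_le_one.trans hr
  induction m with
  | zero => simp
  | succ m ih =>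
    have h : a ^ (m + 1) - b ^ (m + 1) = a ^ m * (a - b) + (a ^ m - b ^ m) * b := by
      rw [pow_succ, pow_succ]; noncomm_ring
    have h1 : ‖a ^ m * (a - b)‖ ≤ r ^ (m + 1) * ‖a - b‖ := by
      refine (norm_mul_le _ _).trans (mul_le_mul_of_nonneg_right ?_ (norm_nonneg _))
      exact (norm_pow_le _ _).trans ((pow_le_pow_left₀ (norm_nonneg _) ha _).trans
        (pow_le_pow_right₀ hr (Nat.le_succ _)))
    have h2 : ‖(a ^ m - b ^ m) * b‖ ≤ m * r ^ m * ‖a - b‖ * r :=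
      (norm_mul_le _ _).trans (mul_le_mul ih hb (norm_nonneg _) (by positivity))
    rw [h]
    refine (norm_add_le _ _).trans ((add_le_add h1 h2).trans (le_of_eq ?_))
    push_cast
    ring

variable [NormedAlgebra ℝ 𝔸] [CompleteSpace 𝔸]

theorem exp_smul_of_isIdempotentElem {p : 𝔸} (hp : IsIdempotentElem p) (a : ℝ) :
    exp (a • p) = 1 + (Real.exp a - 1) • p := by
  have h := exp_series_hasSum_exp' (𝕂 := ℝ) (a • p)
  have h1 : HasSum (fun k : ℕ => ((k.factorial : ℝ)⁻¹ • a ^ k) • p) (Real.exp a • p) := by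
    have := exp_series_hasSum_exp' (𝕂 := ℝ) a
    rw [← Real.exp_eq_exp_ℝ] at this
    exact this.smul_const p
  have h2 : HasSum (fun k : ℕ => if k = 0 then 1 - p else 0) (1 - p) := hasSum_ite_eq 0 (1 - p)
  refine (h.unique ((h1.add h2).congr_fun ?_)).trans ?_
  · intro k
    cases k with
    | zero => simp
    | succ k =>
      rw [smul_pow, hp.pow_succ_eq]
      simp [smul_smul]
  · rw [sub_smul, one_smul]; abel

variable [NormOneClass 𝔸]

theorem norm_exp_le_exp_norm (x : 𝔸) : ‖exp x‖ ≤ Real.exp ‖x‖ := by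
  have h := exp_series_hasSum_exp' (𝕂 := ℝ) x
  have h' := exp_series_hasSum_exp' (𝕂 := ℝ) ‖x‖
  rw [← Real.exp_eq_exp_ℝ] at h'
  refine h.norm_le_of_bounded h' fun k => ?_
  rw [norm_smul, smul_eq_mul, norm_inv, Real.norm_natCast]
  gcongr
  exact norm_pow_le _ _

/-- The Lie–Trotter product formula. -/
theorem tendsto_exp_mul_exp_pow (x y : 𝔸) :
    Tendsto (fun m : ℕ => (exp ((m : ℝ)⁻¹ • x) * exp ((m : ℝ)⁻¹ • y)) ^ m) atTop
      (𝓝 (exp (x + y))) := by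
  -- The one-step error `h` has zero derivative at 0, so m‖h(1/m)‖ → 0; telescoping over m factors
  -- costs only m times a bounded constant.
  let h : ℝ → 𝔸 := fun s => exp (s • x) * exp (s • y) - exp (s • (x + y))
  have hd : HasDerivAt h 0 0 := by
    have := ((hasDerivAt_exp_smul_const (𝕂 := ℝ) x (0 : ℝ)).mul
      (hasDerivAt_exp_smul_const (𝕂 := ℝ) y (0 : ℝ))).sub
      (hasDerivAt_exp_smul_const (𝕂 := ℝ) (x + y) (0 : ℝ))
    exact this.congr_deriv (by simp)
  have hinv : Tendsto (fun m : ℕ => (m : ℝ)⁻¹) atTop (𝓝[≠] 0) :=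
    tendsto_nhdsWithin_iff.2 ⟨tendsto_inv_atTop_nhds_zero_nat, by
      filter_upwards [eventually_gt_atTop 0] with m hm
      simp [hm.ne']⟩
  have hlim : Tendsto (fun m : ℕ => (m : ℝ) * ‖h (m : ℝ)⁻¹‖) atTop (𝓝 0) := by
    have := (hd.tendsto_slope_zero.comp hinv).norm
    simpa [h, Function.comp_def, norm_smul] using this
  have hb : ∀ᶠ m : ℕ in atTop,
      ‖(exp ((m : ℝ)⁻¹ • x) * exp ((m : ℝ)⁻¹ • y)) ^ m - exp (x + y)‖ ≤
        Real.exp (‖x‖ + ‖y‖) * ((m : ℝ) * ‖h (m : ℝ)⁻¹‖) := by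
    filter_upwards [eventually_gt_atTop 0] with m hm
    have hm' : (0 : ℝ) < m := by exact_mod_cast hm
    have e1 : exp (x + y) = exp ((m : ℝ)⁻¹ • (x + y)) ^ m := by
      let _ : NormedAlgebra ℚ 𝔸 := .restrictScalars ℚ ℝ 𝔸
      rw [← exp_nsmul, ← Nat.cast_smul_eq_nsmul ℝ, smul_smul, mul_inv_cancel₀ hm'.ne', one_smul]
    have na : ‖exp ((m : ℝ)⁻¹ • x) * exp ((m : ℝ)⁻¹ • y)‖ ≤ Real.exp ((m : ℝ)⁻¹ * (‖x‖ + ‖y‖)) := by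
      refine (norm_mul_le _ _).trans ?_
      rw [mul_add, Real.exp_add]
      refine mul_le_mul ((norm_exp_le_exp_norm _).trans ?_) ((norm_exp_le_exp_norm _).trans ?_)
        (norm_nonneg _) (Real.exp_nonneg _) <;> simp [norm_smul]
    have nb : ‖exp ((m : ℝ)⁻¹ • (x + y))‖ ≤ Real.exp ((m : ℝ)⁻¹ * (‖x‖ + ‖y‖)) := by
      refine (norm_exp_le_exp_norm _).trans (Real.exp_le_exp.2 ?_)
      rw [norm_smul, norm_inv, Real.norm_natCast]
      exact mul_le_mul_of_nonneg_left (norm_add_le _ _) (by positivity)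
    rw [e1]
    refine (norm_pow_sub_pow_le na nb (Real.one_le_exp (by positivity)) m).trans (le_of_eq ?_)
    rw [← Real.exp_nat_mul, mul_inv_cancel_left₀ hm'.ne']
    ring
  rw [tendsto_iff_norm_sub_tendsto_zero]
  refine squeeze_zero' (Eventually.of_forall fun _ => norm_nonneg _) hb ?_
  simpa using hlim.const_mul (Real.exp (‖x‖ + ‖y‖))

end Trotter

/-! ### Golden–Thompson and exponentials of symmetric matrices -/

namespace Matrix

open Filter Topology NormedSpace

variable {n : Type*} [Fintype n] [DecidableEq n]

open scoped Matrix.Norms.Operator in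
/-- The Golden–Thompson inequality. -/
theorem trace_exp_add_le {A B : Matrix n n ℝ} (hA : A.IsSymm) (hB : B.IsSymm) :
    (exp (A + B)).trace ≤ (exp A * exp B).trace := by
  cases isEmpty_or_nonempty n
  · simp [trace]
  have hlim := (tendsto_exp_mul_exp_pow A B).comp (tendsto_pow_atTop_atTop_of_one_lt one_lt_two)
  have hc : Continuous (trace : Matrix n n ℝ → ℝ) := continuous_id.matrix_trace
  refine le_of_tendsto ((hc.tendsto _).comp hlim) (Eventually.of_forall fun k => ?_)
  have hk : ((2 ^ k : ℕ) : ℝ) ≠ 0 := by positivity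
  have e : ∀ C : Matrix n n ℝ, exp ((((2 ^ k : ℕ) : ℝ))⁻¹ • C) ^ 2 ^ k = exp C := fun C => by
    rw [← Matrix.exp_nsmul, ← Nat.cast_smul_eq_nsmul ℝ, smul_smul, mul_inv_cancel₀ hk, one_smul]
  have := trace_mul_pow_two_pow_le ((hA.smul (((2 ^ k : ℕ) : ℝ))⁻¹).exp)
    ((hB.smul (((2 ^ k : ℕ) : ℝ))⁻¹).exp) k
  rw [e, e] at this
  exact this

open scoped Matrix.Norms.Operator in
-- For nonzero v, vvᵀ/N is idempotent, so the exponential series collapses. The case v = 0 covers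
-- samples at common zeros of the basis.
theorem exp_smul_vecMulVec_self {v : n → ℝ} {N : ℝ} (hN : N ≠ 0) (hv : v ⬝ᵥ v = N ∨ v = 0) (θ : ℝ) :
    exp (θ • vecMulVec v v) = 1 + ((Real.exp (θ * N) - 1) / N) • vecMulVec v v := by
  cases isEmpty_or_nonempty n
  · exact Subsingleton.elim _ _
  rcases hv with hv | rfl
  · have hp : IsIdempotentElem (N⁻¹ • vecMulVec v v) := by
      rw [IsIdempotentElem, smul_mul_smul_comm, vecMulVec_mul_vecMulVec, hv, vecMulVec_smul, smul_smul,
        mul_assoc, inv_mul_cancel₀ hN, mul_one]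
    have := exp_smul_of_isIdempotentElem hp (θ * N)
    rwa [smul_smul, smul_smul, mul_assoc, mul_inv_cancel₀ hN, mul_one, ← div_eq_mul_inv] at this
  · simp

theorem trace_exp_smul_eq_sum {A : Matrix n n ℝ} (hA : A.IsHermitian) (θ : ℝ) :
    (exp (θ • A)).trace = ∑ i, Real.exp (θ * hA.eigenvalues i) := by
  let U := Unitary.toUnits hA.eigenvectorUnitary
  have h : θ • A = (U : Matrix n n ℝ) * diagonal (fun i => θ * hA.eigenvalues i) *
      ((U⁻¹ : (Matrix n n ℝ)ˣ) : Matrix n n ℝ) := by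
    conv_lhs => rw [hA.spectral_theorem, Unitary.conjStarAlgAut_apply]
    rw [← smul_mul_assoc, ← mul_smul_comm, ← diagonal_smul]
    rfl
  rw [h, exp_units_conj, trace_mul_comm, ← mul_assoc, Units.inv_mul, one_mul, exp_diagonal,
    trace_diagonal]
  simp [Real.exp_eq_exp_ℝ]

end Matrix

/-! ### Matrix Chernoff bound for isotropic rank-one sums -/

section Chernoff

open Matrix NormedSpace

variable {n ι Ω : Type*}

theorem isSymm_smul_sum_vecMulVec_self (s : Finset ι) (v : ι → n → ℝ) (θ : ℝ) :
    (θ • ∑ i ∈ s, vecMulVec (v i) (v i)).IsSymm := by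
  refine IsSymm.smul ?_ θ
  simp [IsSymm, transpose_sum]

variable [Fintype n] [DecidableEq n]

theorem exp_smul_sum_continuous (s : Finset ι) (θ : ℝ) : Continuous fun v : ι → n → ℝ =>
    exp (θ • ∑ i ∈ s, vecMulVec (v i) (v i)) := by
  open scoped Matrix.Norms.Operator in
  let _ : NormedAlgebra ℚ (Matrix n n ℝ) := .restrictScalars ℚ ℝ _
  refine exp_continuous.comp (Continuous.const_smul (continuous_finsetSum s fun i _ => ?_) θ)
  exact (continuous_apply i).matrix_vecMulVec (continuous_apply i)

/-- The Ahlswede–Winter bound for the trace of the exponential of a sum of independent isotropic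
rank-one matrices of constant norm. -/
theorem integral_trace_exp_smul_sum_le [Fintype ι] [DecidableEq ι]
    [MeasurableSpace Ω] {P : Measure Ω} [IsProbabilityMeasure P]
    {V : ι → Ω → n → ℝ} (hm : ∀ i, Measurable (V i)) (hind : iIndepFun V P) {N : ℝ} (hN1 : 1 ≤ N)
    (hV : ∀ i ω, V i ω ⬝ᵥ V i ω = N ∨ V i ω = 0)
    (hiso : ∀ i a b, ∫ ω, V i ω a * V i ω b ∂P = if a = b then 1 else 0) (θ : ℝ) (s : Finset ι) :
    (∀ a b, Integrable (fun ω => exp (θ • ∑ i ∈ s, vecMulVec (V i ω) (V i ω)) a b) P) ∧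
    ∫ ω, (exp (θ • ∑ i ∈ s, vecMulVec (V i ω) (V i ω))).trace ∂P ≤
      Fintype.card n * (1 + (Real.exp (θ * N) - 1) / N) ^ s.card := by
  have hN : 0 < N := zero_lt_one.trans_le hN1
  have hb : ∀ i ω a, |V i ω a| ≤ √N := fun i ω a => by
    rcases hV i ω with h | h
    · refine Real.abs_le_sqrt ?_
      rw [← h, sq]
      exact Finset.single_le_sum (f := fun a => V i ω a * V i ω a)
        (fun a _ => mul_self_nonneg _) (Finset.mem_univ a)
    · simp [h]
  -- The vectors stay in a compact ball, on which the exponential is bounded.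
  have hint : ∀ (s : Finset ι) a b,
      Integrable (fun ω => exp (θ • ∑ i ∈ s, vecMulVec (V i ω) (V i ω)) a b) P := by
    intro s a b
    have hc : Continuous fun v : ι → n → ℝ => exp (θ • ∑ i ∈ s, vecMulVec (v i) (v i)) a b :=
      (exp_smul_sum_continuous s θ).matrix_elem a b
    obtain ⟨C, hC⟩ := (isCompact_closedBall (0 : ι → n → ℝ) (√N)).exists_bound_of_continuousOn
      hc.continuousOn
    refine Integrable.of_bound (C := C)
      (hc.measurable.comp (measurable_pi_lambda _ hm)).aestronglyMeasurable
      (.of_forall fun ω => hC (fun i => V i ω) ?_)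
    rw [mem_closedBall_zero_iff]
    refine (pi_norm_le_iff_of_nonneg (Real.sqrt_nonneg _)).2 fun i =>
      (pi_norm_le_iff_of_nonneg (Real.sqrt_nonneg _)).2 fun a => hb i ω a
  refine ⟨hint s, ?_⟩
  have hintV : ∀ i a b, Integrable (fun ω => V i ω a * V i ω b) P := fun i a b => by
    refine Integrable.of_bound (C := √N * √N) ((measurable_pi_iff.1 (hm i) a).mul
      (measurable_pi_iff.1 (hm i) b)).aestronglyMeasurable (.of_forall fun ω => ?_)
    rw [norm_mul]
    exact mul_le_mul (hb i ω a) (hb i ω b) (norm_nonneg _) (Real.sqrt_nonneg _)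
  have hexp : ∀ i a b, ∫ ω, exp (θ • vecMulVec (V i ω) (V i ω)) a b ∂P =
      if a = b then 1 + (Real.exp (θ * N) - 1) / N else 0 := fun i a b => by
    simp_rw [exp_smul_vecMulVec_self hN.ne' (hV i _) θ, Matrix.add_apply, Matrix.smul_apply, vecMulVec_apply,
      smul_eq_mul]
    rw [integral_add (integrable_const _) ((hintV i a b).const_mul _), integral_const_mul, hiso]
    by_cases h : a = b
    · subst h; simp
    · simp [h]
  induction s using Finset.induction_on with
  | empty => simp
  | insert i s hi ih =>
    set F : Ω → Matrix n n ℝ := fun ω => exp (θ • ∑ j ∈ s, vecMulVec (V j ω) (V j ω)) with hF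
    set G : Ω → Matrix n n ℝ := fun ω => exp (θ • vecMulVec (V i ω) (V i ω)) with hG
    have hGint : ∀ a b, Integrable (fun ω => G ω a b) P := fun a b => by
      simpa using hint {i} a b
    have hFG : ∀ a b, IndepFun (fun ω => F ω a b) (fun ω => G ω b a) P := fun a b => by
      have h0 := hind.indepFun_finset s {i} (by simpa using hi) hm
      let f : (s → n → ℝ) → ℝ := fun v => exp (θ • ∑ j ∈ s.attach, vecMulVec (v j) (v j)) a b
      let g : (({i} : Finset ι) → n → ℝ) → ℝ := fun v =>
        exp (θ • ∑ j ∈ Finset.univ, vecMulVec (v j) (v j)) b a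
      have h1 := h0.comp (φ := f) (ψ := g)
        ((exp_smul_sum_continuous _ θ).matrix_elem a b).measurable
        ((exp_smul_sum_continuous _ θ).matrix_elem b a).measurable
      convert h1 using 1
      · funext ω
        simp only [hF, f, Function.comp]
        rw [Finset.sum_attach s (fun j => vecMulVec (V j ω) (V j ω))]
      · funext ω
        simp [hG, g]
    have hmul : ∀ a b, Integrable (fun ω => F ω a b * G ω b a) P := fun a b =>
      (hFG a b).integrable_mul (hint s a b) (hGint b a)
    -- For negative θ this relies on 1 ≤ N.
    have hgnn : 0 ≤ 1 + (Real.exp (θ * N) - 1) / N := by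
      have h1 : (Real.exp (θ * N) - 1) / N = Real.exp (θ * N) / N - N⁻¹ := by
        rw [sub_div, one_div]
      have h2 : 0 ≤ Real.exp (θ * N) / N := by positivity
      linarith [inv_le_one_of_one_le₀ hN1]
    calc ∫ ω, (exp (θ • ∑ j ∈ insert i s, vecMulVec (V j ω) (V j ω))).trace ∂P
        ≤ ∫ ω, ∑ a, ∑ b, F ω a b * G ω b a ∂P := by
          refine integral_mono (integrable_finsetSum _ fun a _ => hint _ a a)
            (integrable_finsetSum _ fun a _ => integrable_finsetSum _ fun b _ => hmul a b)
            fun ω => ?_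
          have h := trace_exp_add_le (isSymm_smul_sum_vecMulVec_self s (fun j => V j ω) θ)
            (isSymm_smul_sum_vecMulVec_self {i} (fun j => V j ω) θ)
          rw [← smul_add, add_comm, Finset.sum_singleton] at h
          rw [Finset.sum_insert hi]
          exact h
      _ = (∫ ω, (F ω).trace ∂P) * (1 + (Real.exp (θ * N) - 1) / N) := by
          rw [integral_finsetSum _ fun a _ => integrable_finsetSum _ fun b _ => hmul a b]
          simp only [trace, diag_apply]
          rw [integral_finsetSum _ fun a _ => hint s a a, Finset.sum_mul]
          refine Finset.sum_congr rfl fun a _ => ?_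
          rw [integral_finsetSum _ fun b _ => hmul a b]
          have : ∀ b, ∫ ω, F ω a b * G ω b a ∂P = (∫ ω, F ω a b ∂P) * ∫ ω, G ω b a ∂P := fun b =>
            (hFG a b).integral_fun_mul_eq_mul_integral (hint s a b).aestronglyMeasurable
              (hGint b a).aestronglyMeasurable
          have hexp' : ∀ b, ∫ ω, G ω b a ∂P =
              if b = a then 1 + (Real.exp (θ * N) - 1) / N else 0 := fun b => hexp i b a
          simp only [this, hexp', mul_ite, mul_zero, Finset.sum_ite_eq', Finset.mem_univ, if_true]
          rfl
      _ ≤ _ := by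
          rw [Finset.card_insert_of_notMem hi, pow_succ, ← mul_assoc]
          exact mul_le_mul_of_nonneg_right ih hgnn

/-- Markov's inequality with θ = x/N: since eˣ - 1 ≤ x + x², the mean costs x + x² against a
threshold x + 2x², leaving x². Either sign of x is allowed, giving both tails. -/
theorem measureReal_trace_exp_ge_le [Fintype ι] [DecidableEq ι]
    [MeasurableSpace Ω] {P : Measure Ω} [IsProbabilityMeasure P]
    {V : ι → Ω → n → ℝ} (hm : ∀ i, Measurable (V i)) (hind : iIndepFun V P) {N : ℝ} (hN : 1 ≤ N)
    (hV : ∀ i ω, V i ω ⬝ᵥ V i ω = N ∨ V i ω = 0)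
    (hiso : ∀ i a b, ∫ ω, V i ω a * V i ω b ∂P = if a = b then 1 else 0) {x : ℝ} (hx : |x| ≤ 1) :
    P.real {ω | Real.exp (Fintype.card ι / N * (x + 2 * x ^ 2)) ≤
      (exp ((x / N) • ∑ i, vecMulVec (V i ω) (V i ω))).trace} ≤
      Fintype.card n * Real.exp (-(Fintype.card ι / N * x ^ 2)) := by
  have hN0 : 0 < N := zero_lt_one.trans_le hN
  obtain ⟨hint, hle⟩ := integral_trace_exp_smul_sum_le hm hind hN hV hiso (x / N) Finset.univ
  set m : ℝ := (Fintype.card ι : ℝ) with hmdef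
  set Z : Ω → ℝ := fun ω => (exp ((x / N) • ∑ i, vecMulVec (V i ω) (V i ω))).trace with hZ
  have hZint : Integrable Z P := integrable_finsetSum _ fun a _ => hint a a
  have hZ0 : ∀ ω, 0 ≤ Z ω := fun ω => by
    have hH : (∑ i, vecMulVec (V i ω) (V i ω)).IsHermitian := by
      simpa [IsHermitian, IsSymm, conjTranspose_eq_transpose_of_trivial] using
        isSymm_smul_sum_vecMulVec_self Finset.univ (fun i => V i ω) 1
    rw [hZ]
    simp only [trace_exp_smul_eq_sum hH]
    positivity
  have hmarkov := mul_meas_ge_le_integral_of_nonneg (.of_forall hZ0) hZint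
    (Real.exp (m / N * (x + 2 * x ^ 2)))
  rw [div_mul_cancel₀ _ hN0.ne', Finset.card_univ] at hle
  have hg0 : 0 ≤ 1 + (Real.exp x - 1) / N := by
    have h2 : 0 ≤ Real.exp x / N := by positivity
    rw [sub_div, one_div]
    linarith [inv_le_one_of_one_le₀ hN]
  have hg : (1 + (Real.exp x - 1) / N) ^ Fintype.card ι ≤ Real.exp (m / N * (x + x ^ 2)) := by
    have h1 : Real.exp x - 1 ≤ x + x ^ 2 := by
      have := (abs_le.1 (Real.abs_exp_sub_one_sub_id_le hx)).2
      linarith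
    have h2 : 1 + (Real.exp x - 1) / N ≤ Real.exp ((x + x ^ 2) / N) := by
      have := Real.add_one_le_exp ((x + x ^ 2) / N)
      have h3 := div_le_div_of_nonneg_right h1 hN0.le
      linarith
    refine (pow_le_pow_left₀ hg0 h2 _).trans (le_of_eq ?_)
    rw [← Real.exp_nat_mul]
    congr 1
    rw [hmdef]
    ring
  have h : Real.exp (m / N * (x + 2 * x ^ 2)) *
      P.real {ω | Real.exp (m / N * (x + 2 * x ^ 2)) ≤ Z ω} ≤
      Real.exp (m / N * (x + 2 * x ^ 2)) * (Fintype.card n * Real.exp (-(m / N * x ^ 2))) := by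
    refine (hmarkov.trans hle).trans ((mul_le_mul_of_nonneg_left hg (by positivity)).trans
      (le_of_eq ?_))
    rw [mul_left_comm, ← Real.exp_add]
    congr 2
    ring
  exact le_of_mul_le_mul_left h (Real.exp_pos _)

end Chernoff

/-! ### From a small determinant to a deviating eigenvalue -/

namespace PCE

open Matrix

theorem sub_two_mul_sq_le_log {y : ℝ} (hy : |y - 1| ≤ 1 / 2) : (y - 1) - 2 * (y - 1) ^ 2 ≤ Real.log y := by
  have habs : |1 - y| ≤ 1 / 2 := by rwa [abs_sub_comm]
  have h := (abs_le.1 (Real.abs_log_sub_add_sum_range_le (x := 1 - y) (by linarith) 1)).1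
  have h2 : |1 - y| ^ 2 / (1 - |1 - y|) ≤ 2 * (y - 1) ^ 2 := by
    rw [div_le_iff₀ (by linarith), sq_abs]
    nlinarith [sq_nonneg (y - 1)]
  norm_num at h h2
  linarith

/-- If the eigenvalues of a matrix have mean `1`, a small value of the D-optimality criterion forces
an eigenvalue at distance of order `√(1 - t)` from `1`. -/
theorem exists_eigenvalue_of_phiD_le {K : ℕ} (hK : 0 < K) {A : Matrix (Fin K) (Fin K) ℝ}
    (hA : A.IsHermitian) (htr : A.trace = K) {t : ℝ} (ht0 : 0 < t) (ht1 : t < 1)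
    (h : phiD A ≤ t) : ∃ i, √(1 - t) / 2 ≤ |hA.eigenvalues i - 1| := by
  by_contra! hcon
  set δ := √(1 - t) / 2 with hδ
  have hδ2 : δ ^ 2 = (1 - t) / 4 := by
    rw [hδ, div_pow, Real.sq_sqrt (by linarith)]; norm_num
  have hδ1 : δ ≤ 1 / 2 := by
    have : √(1 - t) ≤ 1 := Real.sqrt_le_one.2 (by linarith)
    linarith
  have hsum : ∑ i, hA.eigenvalues i = K := by
    rw [← htr, hA.trace_eq_sum_eigenvalues]; simp
  have hpos : ∀ i, 0 < hA.eigenvalues i := fun i => by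
    have := (abs_lt.1 (hcon i)).1
    linarith
  have hK' : (0 : ℝ) < K := by exact_mod_cast hK
  have hdet : A.det = ∏ i, hA.eigenvalues i := by
    rw [hA.det_eq_prod_eigenvalues]; simp
  have hdet0 : 0 < A.det := hdet ▸ Finset.prod_pos fun i _ => hpos i
  -- The linear terms sum to zero because the eigenvalues sum to `K`. The resulting lower bound 1 -
  -- 2δ² = (1+t)/2 on `phiD` exceeds t.
  have hlog : -(2 * K * δ ^ 2) ≤ Real.log A.det := by
    rw [hdet, Real.log_prod fun i _ => (hpos i).ne']
    have h1 : ∀ i, (hA.eigenvalues i - 1) - 2 * δ ^ 2 ≤ Real.log (hA.eigenvalues i) := fun i => by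
      have h2 : (hA.eigenvalues i - 1) ^ 2 ≤ δ ^ 2 := by
        rw [← sq_abs]
        exact pow_le_pow_left₀ (abs_nonneg _) (hcon i).le 2
      linarith [sub_two_mul_sq_le_log ((hcon i).le.trans hδ1)]
    refine le_trans (le_of_eq ?_) (Finset.sum_le_sum fun i _ => h1 i)
    simp [Finset.sum_sub_distrib, hsum]
    ring
  have hphi : Real.exp (-(2 * δ ^ 2)) ≤ phiD A := by
    rw [phiD, Real.rpow_def_of_pos hdet0]
    refine Real.exp_le_exp.2 ?_
    rw [mul_one_div, le_div_iff₀ hK']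
    linarith
  have := Real.add_one_le_exp (-(2 * δ ^ 2))
  linarith

end PCE

/-! ### Coherence-optimal sampling and the tail bound -/

namespace PCE

open Matrix

variable {d K : ℕ} {f : (Fin d → ℝ) → ℝ} {ψ : Fin K → MvPolynomial (Fin d) ℝ}

theorem measurable_eval (p : MvPolynomial (Fin d) ℝ) :
    Measurable fun ξ : Fin d → ℝ => MvPolynomial.eval ξ p :=
  (MvPolynomial.continuous_eval p).measurable

theorem B_sq (ψ : Fin K → MvPolynomial (Fin d) ℝ) (ξ : Fin d → ℝ) :
    B ψ ξ ^ 2 = ∑ k, MvPolynomial.eval ξ (ψ k) ^ 2 := by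
  rw [B, Real.sq_sqrt (by positivity)]
  simp

theorem measurable_B (ψ : Fin K → MvPolynomial (Fin d) ℝ) : Measurable (B ψ) := by
  have := fun k => measurable_eval (ψ k)
  unfold B
  simp only [sq_abs]
  fun_prop

theorem eval_eq_zero_of_B_eq_zero {ξ : Fin d → ℝ} (h : B ψ ξ = 0) (k : Fin K) :
    MvPolynomial.eval ξ (ψ k) = 0 := by
  have h1 := B_sq ψ ξ
  rw [h, zero_pow two_ne_zero, eq_comm, Finset.sum_eq_zero_iff_of_nonneg (by intros; positivity)] at h1
  simpa using h1 k (Finset.mem_univ k)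

theorem integral_mul_B_sq (hψ : IsOrthonormal f ψ) : ∫ ξ, f ξ * B ψ ξ ^ 2 = K := by
  have hint : ∀ k, Integrable fun ξ =>
      MvPolynomial.eval ξ (ψ k) * MvPolynomial.eval ξ (ψ k) * f ξ := fun k => by
    by_contra h
    simpa [integral_undef h] using hψ k k
  have : ∀ ξ, f ξ * B ψ ξ ^ 2 =
      ∑ k, MvPolynomial.eval ξ (ψ k) * MvPolynomial.eval ξ (ψ k) * f ξ := fun ξ => by
    rw [B_sq, Finset.mul_sum]
    exact Finset.sum_congr rfl fun k _ => by ring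
  simp_rw [this]
  rw [integral_finsetSum _ fun k _ => hint k]
  simp [hψ _ _]

theorem normConst_sq (hψ : IsOrthonormal f ψ) : normConst f ψ ^ 2 = (K : ℝ)⁻¹ := by
  rw [normConst, integral_mul_B_sq hψ, ← Real.rpow_natCast, ← Real.rpow_mul (by positivity)]
  norm_num [Real.rpow_neg_one]

theorem weight_sq_mul (hψ : IsOrthonormal f ψ) {ξ : Fin d → ℝ} (h : B ψ ξ ≠ 0) :
    weight f ψ ξ ^ 2 * B ψ ξ ^ 2 = K := by
  rw [weight, div_pow, mul_pow, normConst_sq hψ]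
  rcases Nat.eq_zero_or_pos K with rfl | hK
  · simp
  · have : (K : ℝ) ≠ 0 := by positivity
    field_simp

theorem measurable_weight : Measurable (weight f ψ) :=
  measurable_const.div (measurable_const.mul (measurable_B ψ))

theorem measurable_samplingDensity (hf : IsPDF f) : Measurable (samplingDensity f ψ) :=
  (measurable_const.mul hf.measurable).mul ((measurable_B ψ).pow_const 2)

theorem samplingDensity_nonneg (hf : IsPDF f) (ξ : Fin d → ℝ) : 0 ≤ samplingDensity f ψ ξ := by
  have := hf.nonneg ξ
  unfold samplingDensity
  positivity

theorem integral_samplingLaw (hf : IsPDF f) (g : (Fin d → ℝ) → ℝ) :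
    ∫ ξ, g ξ ∂samplingLaw f ψ = ∫ ξ, samplingDensity f ψ ξ * g ξ := by
  rw [samplingLaw, integral_withDensity_eq_integral_toReal_smul
    (measurable_samplingDensity hf).ennreal_ofReal (.of_forall fun _ => ENNReal.ofReal_lt_top)]
  simp [ENNReal.toReal_ofReal (samplingDensity_nonneg hf _)]

/-- A row of the measurement matrix, as a function of the sample. -/
noncomputable def row (f : (Fin d → ℝ) → ℝ) (ψ : Fin K → MvPolynomial (Fin d) ℝ) (ξ : Fin d → ℝ) :
    Fin K → ℝ :=
  fun j => weight f ψ ξ * MvPolynomial.eval ξ (ψ j)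

theorem measurable_row : Measurable (row f ψ) :=
  measurable_pi_lambda _ fun j => measurable_weight.mul (measurable_eval (ψ j))

theorem row_dotProduct_self (ξ : Fin d → ℝ) :
    row f ψ ξ ⬝ᵥ row f ψ ξ = weight f ψ ξ ^ 2 * B ψ ξ ^ 2 := by
  rw [B_sq, Finset.mul_sum]
  exact Finset.sum_congr rfl fun k _ => by simp only [row]; ring

theorem row_eq_zero {ξ : Fin d → ℝ} (h : B ψ ξ = 0) : row f ψ ξ = 0 := by
  funext j
  simp [row, eval_eq_zero_of_B_eq_zero h]

/-- The squared weight cancels the factor tilting `f` into the sampling density; at zeros of `B`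
both integrands vanish. -/
theorem integral_row_mul_row (hf : IsPDF f) (hψ : IsOrthonormal f ψ) (a b : Fin K) :
    ∫ ξ, row f ψ ξ a * row f ψ ξ b ∂samplingLaw f ψ = if a = b then 1 else 0 := by
  rw [integral_samplingLaw hf, ← hψ a b]
  refine integral_congr_ae (.of_forall fun ξ => ?_)
  by_cases h : B ψ ξ = 0
  · simp [row, eval_eq_zero_of_B_eq_zero h]
  · have hK : (K : ℝ) ≠ 0 := by exact_mod_cast (Fin.pos a).ne'
    have h1 := weight_sq_mul (f := f) hψ h
    simp only [row, samplingDensity, normConst_sq hψ]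
    calc _ = (K : ℝ)⁻¹ * (weight f ψ ξ ^ 2 * B ψ ξ ^ 2) *
          (MvPolynomial.eval ξ (ψ a) * MvPolynomial.eval ξ (ψ b) * f ξ) := by ring
      _ = _ := by rw [h1, inv_mul_cancel₀ hK, one_mul]

theorem ae_B_ne_zero (hf : IsPDF f) : ∀ᵐ ξ ∂samplingLaw f ψ, B ψ ξ ≠ 0 := by
  rw [samplingLaw, ae_withDensity_iff (measurable_samplingDensity hf).ennreal_ofReal]
  refine .of_forall fun ξ h hB => h ?_
  simp [samplingDensity, hB]

theorem informationMatrix_eq {M : ℕ} (ξ : Fin M → Fin d → ℝ) :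
    informationMatrix (weight f ψ) ψ ξ =
      (1 / (M : ℝ)) • ∑ i, vecMulVec (row f ψ (ξ i)) (row f ψ (ξ i)) := by
  rw [informationMatrix]
  congr 1
  ext a b
  rw [mul_apply, Matrix.sum_apply]
  simp only [transpose_apply, measurementMatrix, diagonal_mul, basisMatrix, of_apply,
    vecMulVec_apply, row]

theorem le_coherence (hψ : IsOrthonormal f ψ) (hK : 0 < K) :
    (K : ℝ) ≤ coherence (weight f ψ) ψ := by
  have hval : ∀ ξ, ∑ j, |weight f ψ ξ * MvPolynomial.eval ξ (ψ j)| ^ 2 =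
      weight f ψ ξ ^ 2 * B ψ ξ ^ 2 := fun ξ => by
    rw [B_sq, Finset.mul_sum]
    simp [mul_pow]
  obtain ⟨ξ, hξ⟩ : ∃ ξ, B ψ ξ ≠ 0 := by
    by_contra! h
    have := integral_mul_B_sq hψ
    simp only [h] at this
    norm_num at this
    exact hK.ne (by exact_mod_cast this)
  -- Boundedness is essential: the real supremum of an unbounded family is 0 by convention.
  have hbdd : BddAbove (Set.range fun ξ => ∑ j, |weight f ψ ξ * MvPolynomial.eval ξ (ψ j)| ^ 2) := by
    refine ⟨K, ?_⟩
    rintro _ ⟨ζ, rfl⟩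
    simp only [hval]
    by_cases h : B ψ ζ = 0
    · simp [h]
    · rw [weight_sq_mul hψ h]
  refine le_trans ?_ (le_ciSup hbdd ξ)
  rw [hval, weight_sq_mul hψ hξ]

theorem measureReal_phiD_le {M : ℕ} (hf : IsPDF f) (hψ : IsOrthonormal f ψ) (hK : 0 < K) (hM : 0 < M)
    {Ω : Type*} [MeasurableSpace Ω] {P : Measure Ω} [IsProbabilityMeasure P]
    {Y : Fin M → Ω → (Fin d → ℝ)} (hY : ∀ i, Measurable (Y i)) (hind : iIndepFun Y P)
    (hlaw : ∀ i, P.map (Y i) = samplingLaw f ψ) {t : ℝ} (ht0 : 0 < t) (ht1 : t < 1) :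
    P.real {ω | phiD (informationMatrix (weight f ψ) ψ (fun i => Y i ω)) ≤ t} ≤
      2 * (K : ℝ) * Real.exp (-(M / K * ((1 - t) / 16))) := by
  have hK' : (0 : ℝ) < K := by exact_mod_cast hK
  have hM' : (0 : ℝ) < M := by exact_mod_cast hM
  let V : Fin M → Ω → Fin K → ℝ := fun i ω => row f ψ (Y i ω)
  have hVm : ∀ i, Measurable (V i) := fun i => measurable_row.comp (hY i)
  have hVind : iIndepFun V P := hind.comp (fun _ => row f ψ) fun _ => measurable_row
  have hVV : ∀ i ω, V i ω ⬝ᵥ V i ω = K ∨ V i ω = 0 := fun i ω => by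
    by_cases h : B ψ (Y i ω) = 0
    · exact .inr (row_eq_zero h)
    · exact .inl ((row_dotProduct_self _).trans (weight_sq_mul hψ h))
  have hiso : ∀ i a b, ∫ ω, V i ω a * V i ω b ∂P = if a = b then 1 else 0 := fun i a b => by
    rw [← integral_row_mul_row hf hψ a b, ← hlaw i, integral_map (hY i).aemeasurable]
    exact ((measurable_pi_iff.1 measurable_row a).mul
      (measurable_pi_iff.1 measurable_row b)).aestronglyMeasurable
  -- Half the eigenvalue deviation 2x: the Chernoff exponent 2xs - s² is largest at s = x.
  set x : ℝ := √(1 - t) / 4 with hx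
  have hx2 : x ^ 2 = (1 - t) / 16 := by
    rw [hx, div_pow, Real.sq_sqrt (by linarith)]; norm_num
  have hx0 : 0 ≤ x := by positivity
  have hx1 : |x| ≤ 1 := by
    have : √(1 - t) ≤ 1 := Real.sqrt_le_one.2 (by linarith)
    rw [abs_of_nonneg hx0]
    linarith
  have h1K : (1 : ℝ) ≤ K := by exact_mod_cast hK
  have hup := measureReal_trace_exp_ge_le hVm hVind h1K hVV hiso hx1
  have hlo := measureReal_trace_exp_ge_le hVm hVind h1K hVV hiso (x := -x) (by rwa [abs_neg])
  rw [neg_sq] at hlo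
  simp only [Fintype.card_fin, hx2] at hup hlo
  set E₁ := {ω | Real.exp (M / K * (x + 2 * ((1 - t) / 16))) ≤
    (NormedSpace.exp ((x / K) • ∑ i, vecMulVec (V i ω) (V i ω))).trace}
  set E₂ := {ω | Real.exp (M / K * (-x + 2 * ((1 - t) / 16))) ≤
    (NormedSpace.exp ((-x / K) • ∑ i, vecMulVec (V i ω) (V i ω))).trace}
  have hB : ∀ᵐ ω ∂P, ∀ i, B ψ (Y i ω) ≠ 0 := ae_all_iff.2 fun i =>
    ae_of_ae_map (hY i).aemeasurable ((hlaw i).symm ▸ ae_B_ne_zero hf)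
  have hsub : {ω | phiD (informationMatrix (weight f ψ) ψ (fun i => Y i ω)) ≤ t} ≤ᵐ[P]
      (E₁ ∪ E₂ : Set Ω) := by
    filter_upwards [hB] with ω hω hphi
    set A := informationMatrix (weight f ψ) ψ (fun i => Y i ω)
    have hAeq : A = (1 / (M : ℝ)) • ∑ i, vecMulVec (V i ω) (V i ω) := informationMatrix_eq _
    have hA : A.IsHermitian := by
      rw [hAeq, IsHermitian, conjTranspose_eq_transpose_of_trivial]
      exact isSymm_smul_sum_vecMulVec_self _ (fun i => V i ω) _
    have htr : A.trace = K := by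
      have : ∀ i, V i ω ⬝ᵥ V i ω = K := fun i =>
        (row_dotProduct_self _).trans (weight_sq_mul hψ (hω i))
      rw [hAeq, trace_smul, trace_sum]
      simp only [trace_vecMulVec, this]
      simp [hM'.ne']
    have hS : ∀ y : ℝ, (y / K) • ∑ i, vecMulVec (V i ω) (V i ω) = (M / K * y) • A := fun y => by
      rw [hAeq, smul_smul]
      congr 1
      field_simp
    obtain ⟨i, hi⟩ := exists_eigenvalue_of_phiD_le hK hA htr ht0 ht1 hphi
    have hsingle : ∀ y z : ℝ, z ≤ y * hA.eigenvalues i →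
        Real.exp (M / K * z) ≤
          (NormedSpace.exp ((y / K) • ∑ i, vecMulVec (V i ω) (V i ω))).trace := fun y z hz => by
      rw [hS, trace_exp_smul_eq_sum hA]
      refine le_trans (Real.exp_le_exp.2 ?_) (Finset.single_le_sum
        (f := fun j => Real.exp (M / K * y * hA.eigenvalues j))
        (fun j _ => Real.exp_nonneg _) (Finset.mem_univ i))
      rw [mul_assoc]
      exact mul_le_mul_of_nonneg_left hz (by positivity)
    have hi' : 2 * x ≤ |hA.eigenvalues i - 1| := by linarith
    rcases le_abs.1 hi' with h | h
    · exact .inl (hsingle x _ (by nlinarith))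
    · exact .inr (hsingle (-x) _ (by nlinarith))
  calc _ ≤ P.real (E₁ ∪ E₂) := ENNReal.toReal_mono (measure_ne_top _ _) (measure_mono_ae hsub)
    _ ≤ P.real E₁ + P.real E₂ := measureReal_union_le _ _
    _ ≤ _ := by linarith

end PCE

theorem theorem1 :
    ∃ c : ℝ, 0 < c ∧
      ∀ (d K M : ℕ) (f : (Fin d → ℝ) → ℝ) (ψ : Fin K → MvPolynomial (Fin d) ℝ),
        PCE.IsPDF f → PCE.IsOrthonormal f ψ → K < M →
        ∀ {Ω : Type*} [MeasurableSpace Ω] (P : Measure Ω) [IsProbabilityMeasure P]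
          (Y : Fin M → Ω → (Fin d → ℝ)),
          (∀ i, Measurable (Y i)) →
          iIndepFun Y P →
          (∀ i, P.map (Y i) = PCE.samplingLaw f ψ) →
          ∀ t : ℝ, 0 < t → t < 1 →
            P.real {ω | PCE.phiD (PCE.informationMatrix (PCE.weight f ψ) ψ (fun i => Y i ω)) ≤ t} ≤
              2 * (K : ℝ) *
                Real.exp (-(c * (M : ℝ) * (PCE.coherence (PCE.weight f ψ) ψ)⁻¹ * (1 - t))) := by
  -- The constant is x²/(1-t) for x = √(1-t)/4.
  refine ⟨1 / 16, by norm_num, ?_⟩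
  intro d K M f ψ hf hψ hKM Ω _ P _ Y hY hind hlaw t ht0 ht1
  rcases Nat.eq_zero_or_pos K with rfl | hK
  -- For K = 0 the empty determinant is 1 and the exponent 1/0 is 0, so `phiD` is 1 > t and the
  -- event is empty.
  · simp [PCE.phiD, not_le.2 ht1]
  refine (PCE.measureReal_phiD_le hf hψ hK (by omega) hY hind hlaw ht0 ht1).trans ?_
  have hK' : (0 : ℝ) < K := by exact_mod_cast hK
  have hcoh := inv_anti₀ hK' (PCE.le_coherence hψ hK)
  refine mul_le_mul_of_nonneg_left (Real.exp_le_exp.2 (neg_le_neg ?_)) (by positivity)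
  calc _ ≤ 1 / 16 * (M : ℝ) * (K : ℝ)⁻¹ * (1 - t) := by
        have : 0 ≤ 1 - t := by linarith
        gcongr
    _ = _ := by ring
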